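/- Call a topological space $X$ selectively sequentially pseudocompact if for every sequence $(U_n)_{n\in\mathbb{N}}$ of non-empty open subsets of $X$ one can choose points $x_n\in U_n$ $(n\in\mathbb{N})$ such that the sequence $(x_n)_{n\in\mathbb{N}}$ has a subsequence converging to a point of $X$. Let $\sigma$ be an infinite cardinal such that $\sigma^{\omega}=\sigma$. Then the free group on $\sigma$ generators admits a Hausdorff group topology that is connected, locally connected and selectively sequentially pseudocompact. Moreover, this topology can be chosen so that the resulting topological group is topologically isomorphic to a dense subgroup of the product group $SO(3,\mathbb{R})^{\sigma}$, equipped with the product topology, where $SO(3,\mathbb{R})$ has its usual compact metric topology. -/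

import Mathlib

open Topology Filter

universe u

/-- Every sequence of non-empty open sets has a choice of points `x n ∈ U n` such that the
sequence `x` has a convergent subsequence. -/
def SelectivelySequentiallyPseudocompact (X : Type*) [TopologicalSpace X] : Prop :=
  ∀ U : ℕ → Set X, (∀ n, IsOpen (U n) ∧ (U n).Nonempty) →
    ∃ x : ℕ → X, (∀ n, x n ∈ U n) ∧
      ∃ (a : X) (φ : ℕ → ℕ), StrictMono φ ∧ Tendsto (x ∘ φ) atTop (𝓝 a)

/-- The group `SO(3, ℝ)` of real orthogonal `3 × 3` matrices of determinant one; its topology is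
the subspace topology from the space of matrices (entrywise convergence). -/
abbrev SO3 : Type := Matrix.specialOrthogonalGroup (Fin 3) ℝ

/-!
The free group is realised as a dense subgroup `D` of `S → SO3` generated by points that are chosen
so that `D` satisfies three requirements.

* Every convergent sequence, with its limit, prescribed on countably many coordinates is attained
  by generators converging on all coordinates. There are only `σ ^ ℵ₀ = σ` prescriptions, so one
  generator can be spent on each term and each limit (`mk_generator`). In particular `D` takes all
  prescribed values on countably many coordinates (`exists_generatorValue_eq`), which gives density.
* The remaining coordinates of the generators ensure freeness. Each coordinate is labelled by a
  word, every word being used uncountably often, and there the generators take values in `SO3` at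
  which that word is not `1`. A word involves finitely many letters, so these values can be taken
  eventually constant along each prescribed sequence, which preserves convergence. A given word
  has a coordinate with its label at which none of its letters is prescribed
  (`injective_lift_generatorValue`).
* That every non-trivial word `w` has a non-trivial value in `SO3` (`exists_lift_SO3_ne_one`) is
  seen by complexifying: rotations about distinct horizontal axes with tangent of half-angle `t`
  are matrices of polynomials in `t` divided by `1 + t ^ 2`. If `w` were `1` for all real `t`, the
  product of the numerators would vanish at `t = i`; but there the numerators have rank one and
  along a reduced word none annihilates the next.

Selective sequential pseudocompactness: membership in a given sequence of open sets is decided, near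
chosen points, by countably many coordinates; on these a subsequence of the points converges by
compactness, and the generators prescribed by this subsequence lie in the same open sets
(`exists_generatorValue_mem`) and converge (`tendsto_generatorValue`).

Connectedness and local connectedness pass from `S → SO3` to `D`
(`IsPreconnected.inter_of_forall_countable`) because the closure of an open set in a power of a
compact group depends on countably many coordinates (`exists_countable_dependsOn_closure`), which
`D` cannot distinguish from the whole power. The rotation group itself is covered by translates of
the open image of the Euler–Rodrigues parametrization by `ℝ³`.
-/

/-! ### The rotation group -/

instance SO3.instIsTopologicalGroup : IsTopologicalGroup SO3 where
  continuous_inv := by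
    refine Continuous.subtype_mk ?_ _
    exact (continuous_subtype_val (p := fun A : Matrix (Fin 3) (Fin 3) ℝ =>
      A ∈ Matrix.specialOrthogonalGroup (Fin 3) ℝ)).matrix_conjTranspose

instance SO3.instSecondCountableTopology : SecondCountableTopology SO3 := by
  have : SecondCountableTopology (Matrix (Fin 3) (Fin 3) ℝ) :=
    inferInstanceAs (SecondCountableTopology (Fin 3 → Fin 3 → ℝ))
  exact TopologicalSpace.Subtype.secondCountableTopology
    (Matrix.specialOrthogonalGroup (Fin 3) ℝ : Set (Matrix (Fin 3) (Fin 3) ℝ))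

theorem SO3.mul_transpose (A : SO3) : A.1 * A.1.transpose = 1 := by
  have := (Matrix.mem_specialOrthogonalGroup_iff.1 A.2).1
  rw [Matrix.mem_orthogonalGroup_iff] at this
  simpa [Matrix.star_eq_conjTranspose] using this

theorem SO3.transpose_mul (A : SO3) : A.1.transpose * A.1 = 1 :=
  mul_eq_one_comm.1 A.mul_transpose

theorem SO3.det_eq_one (A : SO3) : A.1.det = 1 :=
  (Matrix.mem_specialOrthogonalGroup_iff.1 A.2).2

theorem SO3.adjugate_eq_transpose (A : SO3) : A.1.adjugate = A.1.transpose := by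
  have h := congrArg (A.1.transpose * ·) A.1.mul_adjugate
  simpa [← mul_assoc, A.transpose_mul, A.det_eq_one] using h

instance SO3.instCompactSpace : CompactSpace SO3 := by
  refine (isCompact_iff_compactSpace (s := ((Matrix.specialOrthogonalGroup (Fin 3) ℝ :
    Submonoid _) : Set (Matrix (Fin 3) (Fin 3) ℝ)))).1 ?_
  have hK : IsCompact (Set.pi Set.univ fun _ : Fin 3 => Set.pi Set.univ fun _ : Fin 3 =>
      Set.Icc (-1 : ℝ) 1) :=
    isCompact_univ_pi fun _ => isCompact_univ_pi fun _ => isCompact_Icc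
  refine IsCompact.of_isClosed_subset (X := Matrix (Fin 3) (Fin 3) ℝ) hK ?_ ?_
  · have : ((Matrix.specialOrthogonalGroup (Fin 3) ℝ : Submonoid _) :
        Set (Matrix (Fin 3) (Fin 3) ℝ)) = {A | A * A.transpose = 1} ∩ {A | A.det = 1} := by
      ext A
      simp [Matrix.mem_specialOrthogonalGroup_iff, Matrix.mem_orthogonalGroup_iff]
    rw [this]
    exact (isClosed_eq (by fun_prop) continuous_const).inter
      (isClosed_eq (by fun_prop) continuous_const)
  · intro A hA i _ j _
    have h := congrFun (congrFun (SO3.mul_transpose ⟨A, hA⟩) i) i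
    simp only [Matrix.mul_apply, Matrix.transpose_apply, Matrix.one_apply_eq] at h
    have h1 : A i j * A i j ≤ 1 := by
      rw [← h]
      exact Finset.single_le_sum (f := fun k => A i k * A i k)
        (fun k _ => mul_self_nonneg _) (Finset.mem_univ j)
    constructor <;> nlinarith

/-- The numerator of the Euler–Rodrigues formula: `1 + b² + c² + d²` times the rotation given by
the quaternion `1 + b i + c j + d k`. -/
def rodriguesMatrix {R : Type*} [CommRing R] (b c d : R) : Matrix (Fin 3) (Fin 3) R :=
  !![1 + b ^ 2 - c ^ 2 - d ^ 2, 2 * (b * c - d), 2 * (b * d + c);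
     2 * (b * c + d), 1 - b ^ 2 + c ^ 2 - d ^ 2, 2 * (c * d - b);
     2 * (b * d - c), 2 * (c * d + b), 1 - b ^ 2 - c ^ 2 + d ^ 2]

theorem rodriguesMatrix_map {R S : Type*} [CommRing R] [CommRing S] (φ : R →+* S) (b c d : R) :
    (rodriguesMatrix b c d).map φ = rodriguesMatrix (φ b) (φ c) (φ d) := by
  ext i j
  fin_cases i <;> fin_cases j <;> simp [rodriguesMatrix, map_ofNat φ 2]

theorem rodriguesMatrix_mul_neg {R : Type*} [CommRing R] (b c d : R) :
    rodriguesMatrix b c d * rodriguesMatrix (-b) (-c) (-d) =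
      (1 + b ^ 2 + c ^ 2 + d ^ 2) ^ 2 • 1 := by
  ext i j
  fin_cases i <;> fin_cases j <;>
    simp [rodriguesMatrix, Matrix.mul_apply, Fin.sum_univ_three] <;> ring

theorem rodriguesMatrix_transpose {R : Type*} [CommRing R] (b c d : R) :
    (rodriguesMatrix b c d).transpose = rodriguesMatrix (-b) (-c) (-d) := by
  ext i j
  fin_cases i <;> fin_cases j <;> simp [rodriguesMatrix] <;> ring

theorem rodriguesMatrix_det {R : Type*} [CommRing R] (b c d : R) :
    (rodriguesMatrix b c d).det = (1 + b ^ 2 + c ^ 2 + d ^ 2) ^ 3 := by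
  simp [rodriguesMatrix, Matrix.det_fin_three]
  ring

/-- The rotation given by the quaternion `1 + b i + c j + d k`. -/
noncomputable def rodrigues (b c d : ℝ) : SO3 :=
  ⟨(1 + b ^ 2 + c ^ 2 + d ^ 2)⁻¹ • rodriguesMatrix b c d, by
    have hN : 1 + b ^ 2 + c ^ 2 + d ^ 2 ≠ 0 := by positivity
    rw [Matrix.mem_specialOrthogonalGroup_iff, Matrix.mem_orthogonalGroup_iff]
    constructor
    · rw [Matrix.transpose_smul, rodriguesMatrix_transpose, Matrix.smul_mul, Matrix.mul_smul,
        rodriguesMatrix_mul_neg, smul_smul, smul_smul]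
      convert one_smul ℝ _
      field_simp
    · rw [Matrix.det_smul, rodriguesMatrix_det]
      simp [hN]⟩

theorem rodrigues_inv (b c d : ℝ) : (rodrigues b c d)⁻¹ = rodrigues (-b) (-c) (-d) := by
  rw [inv_eq_iff_mul_eq_one]
  refine Subtype.ext ?_
  have hN : 1 + b ^ 2 + c ^ 2 + d ^ 2 ≠ 0 := by positivity
  change (1 + b ^ 2 + c ^ 2 + d ^ 2)⁻¹ • rodriguesMatrix b c d *
    ((1 + (-b) ^ 2 + (-c) ^ 2 + (-d) ^ 2)⁻¹ • rodriguesMatrix (-b) (-c) (-d)) = 1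
  rw [Matrix.smul_mul, Matrix.mul_smul, rodriguesMatrix_mul_neg, smul_smul, smul_smul]
  convert one_smul ℝ _
  rw [neg_sq, neg_sq, neg_sq]
  field_simp

theorem continuous_rodrigues : Continuous fun p : ℝ × ℝ × ℝ => rodrigues p.1 p.2.1 p.2.2 := by
  refine Continuous.subtype_mk (Continuous.smul (f := fun p : ℝ × ℝ × ℝ =>
    (1 + p.1 ^ 2 + p.2.1 ^ 2 + p.2.2 ^ 2)⁻¹) (g := fun p : ℝ × ℝ × ℝ =>
    rodriguesMatrix p.1 p.2.1 p.2.2) (Continuous.inv₀ (by fun_prop) fun p => by positivity) ?_) _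
  refine continuous_matrix fun i j => ?_
  fin_cases i <;> fin_cases j <;> simp [rodriguesMatrix] <;> fun_prop

theorem rodrigues_apply (b c d : ℝ) (i j : Fin 3) :
    (rodrigues b c d).1 i j = (1 + b ^ 2 + c ^ 2 + d ^ 2)⁻¹ * rodriguesMatrix b c d i j := rfl

theorem one_add_trace_rodrigues (b c d : ℝ) :
    1 + (rodrigues b c d).1.trace = 4 / (1 + b ^ 2 + c ^ 2 + d ^ 2) := by
  have hN : 1 + b ^ 2 + c ^ 2 + d ^ 2 ≠ 0 := by positivity
  simp only [Matrix.trace_fin_three, rodrigues_apply]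
  simp [rodriguesMatrix]
  field_simp
  ring

/-- The imaginary part of the quaternion with real part `1` representing a rotation whose angle is
not `π`: a left inverse of `rodrigues`. -/
noncomputable def SO3.axis (A : SO3) : ℝ × ℝ × ℝ :=
  ((A.1 2 1 - A.1 1 2) / (1 + A.1.trace), (A.1 0 2 - A.1 2 0) / (1 + A.1.trace),
    (A.1 1 0 - A.1 0 1) / (1 + A.1.trace))

theorem SO3.axis_rodrigues (b c d : ℝ) : (rodrigues b c d).axis = (b, c, d) := by
  have hN : 1 + b ^ 2 + c ^ 2 + d ^ 2 ≠ 0 := by positivity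
  simp only [SO3.axis, one_add_trace_rodrigues, rodrigues_apply]
  simp only [rodriguesMatrix, Prod.mk.injEq]
  refine ⟨?_, ?_, ?_⟩ <;> simp <;> field_simp <;> ring

theorem SO3.continuousOn_axis : ContinuousOn SO3.axis {A | 1 + A.1.trace ≠ 0} := by
  have hT : Continuous fun A : SO3 => 1 + A.1.trace := by fun_prop
  have he (i j : Fin 3) : Continuous fun A : SO3 => A.1 i j :=
    (continuous_apply_apply i j).comp continuous_subtype_val
  have h (i j k l : Fin 3) : ContinuousOn (fun A : SO3 => (A.1 i j - A.1 k l) / (1 + A.1.trace))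
      {A | 1 + A.1.trace ≠ 0} :=
    ((he i j).sub (he k l)).continuousOn.div hT.continuousOn fun A hA => hA
  exact (h _ _ _ _).prodMk ((h _ _ _ _).prodMk (h _ _ _ _))

/-- The Euler–Rodrigues parametrization reaches every rotation whose angle is not `π`. -/
theorem SO3.rodrigues_axis (A : SO3) (hA : 1 + A.1.trace ≠ 0) :
    rodrigues A.axis.1 A.axis.2.1 A.axis.2.2 = A := by
  have row (i j : Fin 3) := congrFun (congrFun A.mul_transpose i) j
  have col (i j : Fin 3) := congrFun (congrFun A.transpose_mul i) j
  have cof (i j : Fin 3) := congrFun (congrFun A.adjugate_eq_transpose i) j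
  simp only [Matrix.mul_apply, Fin.sum_univ_three, Matrix.transpose_apply] at row col
  simp only [Matrix.adjugate_fin_three, Matrix.transpose_apply] at cof
  have r00 := row 0 0
  have r11 := row 1 1
  have r22 := row 2 2
  have r01 := row 0 1
  have r02 := row 0 2
  have r12 := row 1 2
  have c00 := col 0 0
  have c11 := col 1 1
  have c22 := col 2 2
  have c01 := col 0 1
  have c02 := col 0 2
  have c12 := col 1 2
  have m00 := cof 0 0
  have m01 := cof 0 1
  have m02 := cof 0 2
  have m10 := cof 1 0
  have m11 := cof 1 1
  have m12 := cof 1 2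
  have m20 := cof 2 0
  have m21 := cof 2 1
  have m22 := cof 2 2
  clear row col cof
  simp at r00 r11 r22 r01 r02 r12 c00 c11 c22 c01 c02 c12 m00 m01 m02 m10 m11 m12 m20 m21 m22
  have hT : 1 + A.1.trace = 1 + A.1 0 0 + A.1 1 1 + A.1 2 2 := by
    rw [Matrix.trace_fin_three]; ring
  -- Orthonormality of rows and columns together with `adjugate A = Aᵀ` express the products of the
  -- entries of the axis by entries of `A`.
  have d0 : (1 + A.1.trace) ^ 2 + (A.1 2 1 - A.1 1 2) ^ 2 = 2 * (1 + A.1.trace) * (1 + A.1 0 0) := by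
    rw [hT]
    linear_combination r11 + r22 - c00 + 2 * m00
  have d1 : (1 + A.1.trace) ^ 2 + (A.1 0 2 - A.1 2 0) ^ 2 = 2 * (1 + A.1.trace) * (1 + A.1 1 1) := by
    rw [hT]
    linear_combination r00 + r22 - c11 + 2 * m11
  have d2 : (1 + A.1.trace) ^ 2 + (A.1 1 0 - A.1 0 1) ^ 2 = 2 * (1 + A.1.trace) * (1 + A.1 2 2) := by
    rw [hT]
    linear_combination r00 + r11 - c22 + 2 * m22
  have o01 : (A.1 2 1 - A.1 1 2) * (A.1 0 2 - A.1 2 0) = (1 + A.1.trace) * (A.1 0 1 + A.1 1 0) := by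
    rw [hT]
    linear_combination m01 + m10 - r01 - c01
  have o02 : (A.1 2 1 - A.1 1 2) * (A.1 1 0 - A.1 0 1) = (1 + A.1.trace) * (A.1 0 2 + A.1 2 0) := by
    rw [hT]
    linear_combination m02 + m20 - r02 - c02
  have o12 : (A.1 0 2 - A.1 2 0) * (A.1 1 0 - A.1 0 1) = (1 + A.1.trace) * (A.1 1 2 + A.1 2 1) := by
    rw [hT]
    linear_combination m12 + m21 - r12 - c12
  refine Subtype.ext ?_
  ext i j
  rw [rodrigues_apply]
  simp only [SO3.axis]
  generalize 1 + A.1.trace = T at *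
  have hN : 1 + ((A.1 2 1 - A.1 1 2) / T) ^ 2 + ((A.1 0 2 - A.1 2 0) / T) ^ 2 +
      ((A.1 1 0 - A.1 0 1) / T) ^ 2 = 4 / T := by
    field_simp
    linear_combination d0 + d1 + d2 - 2 * T * hT
  rw [hN]
  fin_cases i <;> fin_cases j <;> simp [rodriguesMatrix] <;> field_simp
  · linear_combination d0 - d1 - d2 + 2 * T * hT
  · linear_combination 2 * o01
  · linear_combination 2 * o02
  · linear_combination 2 * o01
  · linear_combination d1 - d0 - d2 + 2 * T * hT
  · linear_combination 2 * o12
  · linear_combination 2 * o02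
  · linear_combination 2 * o12
  · linear_combination d2 - d0 - d1 + 2 * T * hT

/-! ### Connectedness of the rotation group -/

theorem isOpenMap_rodrigues : IsOpenMap fun p : ℝ × ℝ × ℝ => rodrigues p.1 p.2.1 p.2.2 := by
  intro U hU
  have hT : Continuous fun A : SO3 => 1 + A.1.trace := by fun_prop
  have hC : IsOpen {A : SO3 | 1 + A.1.trace ≠ 0} := isOpen_ne_fun hT continuous_const
  convert SO3.continuousOn_axis.isOpen_inter_preimage hC hU
  ext A
  constructor
  · rintro ⟨⟨b, c, d⟩, hp, rfl⟩
    refine ⟨?_, ?_⟩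
    · change 1 + (rodrigues b c d).1.trace ≠ 0
      rw [one_add_trace_rodrigues]
      positivity
    · simpa [SO3.axis_rodrigues] using hp
  · rintro ⟨hA, hU⟩
    exact ⟨A.axis, hU, A.rodrigues_axis hA⟩

/-- The half-turn about a coordinate axis is the square of a quarter-turn, and one of the products
of `A` with `1` and the three half-turns has trace different from `-1`: the four numbers
`1 + trace` add up to `4`. -/
theorem SO3.exists_mul_sq_trace_ne (A : SO3) :
    ∃ q : ℝ × ℝ × ℝ, 1 + (A * rodrigues q.1 q.2.1 q.2.2 ^ 2).1.trace ≠ 0 := by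
  by_contra! h
  have h0 := h (0, 0, 0)
  have h1 := h (1, 0, 0)
  have h2 := h (0, 1, 0)
  have h3 := h (0, 0, 1)
  simp only [sq, Submonoid.coe_mul, Matrix.trace_fin_three, Matrix.mul_apply,
    Fin.sum_univ_three, rodrigues_apply] at h0 h1 h2 h3
  simp [rodriguesMatrix] at h0 h1 h2 h3
  linarith

instance SO3.instConnectedSpace : ConnectedSpace SO3 := by
  have hC (p : ℝ × ℝ × ℝ) :
      rodrigues p.1 p.2.1 p.2.2 ∈ Subgroup.connectedComponentOfOne SO3 := by
    have h1 : rodrigues 0 0 0 = 1 := by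
      refine Subtype.ext ?_
      ext i j
      rw [rodrigues_apply]
      fin_cases i <;> fin_cases j <;> simp [rodriguesMatrix]
    refine (isPreconnected_range continuous_rodrigues).subset_connectedComponent
      ⟨(0, 0, 0), h1⟩ ⟨p, rfl⟩
  rw [connectedSpace_iff_connectedComponent]
  refine ⟨1, Set.eq_univ_of_forall fun A => ?_⟩
  change A ∈ Subgroup.connectedComponentOfOne SO3
  obtain ⟨q, hq⟩ := A.exists_mul_sq_trace_ne
  have h := hC (A * rodrigues q.1 q.2.1 q.2.2 ^ 2).axis
  rw [SO3.rodrigues_axis _ hq] at h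
  exact ((Subgroup.connectedComponentOfOne SO3).mul_mem_cancel_right (pow_mem (hC q) 2)).1 h

theorem locallyConnectedSpace_of_isOpenMap {E X : Type*} [TopologicalSpace E]
    [LocallyConnectedSpace E] [TopologicalSpace X]
    (h : ∀ x : X, ∃ f : E → X, Continuous f ∧ IsOpenMap f ∧ x ∈ Set.range f) :
    LocallyConnectedSpace X := by
  rw [locallyConnectedSpace_iff_subsets_isOpen_isConnected]
  intro x U hU
  obtain ⟨f, hf, ho, p, rfl⟩ := h x
  obtain ⟨V, hVU, hVo, hpV, hVc⟩ := locallyConnectedSpace_iff_subsets_isOpen_isConnected.1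
    (inferInstanceAs (LocallyConnectedSpace E)) p (f ⁻¹' U) (hf.continuousAt hU)
  exact ⟨f '' V, Set.image_subset_iff.2 hVU, ho V hVo, ⟨p, hpV, rfl⟩,
    hVc.image f hf.continuousOn⟩

instance SO3.instLocallyConnectedSpace : LocallyConnectedSpace SO3 := by
  refine locallyConnectedSpace_of_isOpenMap (E := ℝ × ℝ × ℝ) fun A => ?_
  obtain ⟨q, hq⟩ := A.exists_mul_sq_trace_ne
  refine ⟨fun p => rodrigues p.1 p.2.1 p.2.2 * (rodrigues q.1 q.2.1 q.2.2 ^ 2)⁻¹,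
    continuous_rodrigues.mul continuous_const,
    (isOpenMap_mul_right _).comp isOpenMap_rodrigues,
    (A * rodrigues q.1 q.2.1 q.2.2 ^ 2).axis, ?_⟩
  change rodrigues _ _ _ * _ = A
  rw [SO3.rodrigues_axis _ hq, mul_inv_cancel_right]

/-! ### Words that do not vanish on rotations -/

theorem FreeGroup.exists_finset_lift_eq {α G : Type*} [Group G] (w : FreeGroup α) :
    ∃ F : Finset α, ∀ f g : α → G, Set.EqOn f g F → FreeGroup.lift f w = FreeGroup.lift g w := by
  classical
  induction w using FreeGroup.induction_on with
  | C1 => exact ⟨∅, fun f g _ => by simp⟩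
  | of x => exact ⟨{x}, fun f g h => by simpa using h⟩
  | inv_of x hx =>
    obtain ⟨F, hF⟩ := hx
    exact ⟨F, fun f g h => by rw [_root_.map_inv, _root_.map_inv, hF f g h]⟩
  | mul x y hx hy =>
    obtain ⟨F, hF⟩ := hx
    obtain ⟨F', hF'⟩ := hy
    refine ⟨F ∪ F', fun f g h => ?_⟩
    rw [_root_.map_mul, _root_.map_mul, hF f g (h.mono (by simp)), hF' f g (h.mono (by simp))]

/-- For `ε = ±1` these are the two isotropic eigenvectors, common to all rotations about the
horizontal axis `(cos θ, sin θ, 0)`. -/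
noncomputable def isotropicVector (θ : ℝ) (ε : ℝ) : Fin 3 → ℂ :=
  ![-(Real.sin θ : ℂ), (Real.cos θ : ℂ), (ε : ℂ) * Complex.I]

/-- At tangent of half-angle `±i` the numerator of the Euler–Rodrigues formula degenerates to a
matrix of rank one. -/
theorem rodriguesMatrix_at_I (θ ε : ℝ) (hε : ε ^ 2 = 1) :
    rodriguesMatrix (ε * Complex.I * (Real.cos θ : ℂ)) (ε * Complex.I * (Real.sin θ : ℂ)) 0 =
      (2 : ℂ) • Matrix.vecMulVec (isotropicVector θ ε) (isotropicVector θ (-ε)) := by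
  have hcs : Complex.cos θ ^ 2 + Complex.sin θ ^ 2 = 1 := Complex.cos_sq_add_sin_sq θ
  have hJ : (ε * Complex.I) ^ 2 = -1 := by
    have hε' : (ε : ℂ) ^ 2 = 1 := by exact_mod_cast hε
    rw [mul_pow, hε', Complex.I_sq, one_mul]
  ext i j
  fin_cases i <;> fin_cases j <;>
    simp [rodriguesMatrix, isotropicVector, -mul_eq_mul_left_iff, -mul_eq_mul_right_iff] <;>
    generalize (ε : ℂ) * Complex.I = J at * <;>
    generalize Complex.cos θ = c at * <;>
    generalize Complex.sin θ = s at *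
  · linear_combination (c ^ 2 - s ^ 2) * hJ - hcs
  · linear_combination 2 * c * s * hJ
  · ring
  · linear_combination 2 * c * s * hJ
  · linear_combination (s ^ 2 - c ^ 2) * hJ - hcs
  · ring
  · linear_combination hJ - J ^ 2 * hcs

theorem isotropicVector_dotProduct (θ θ' ε ε' : ℝ) :
    isotropicVector θ (-ε) ⬝ᵥ isotropicVector θ' ε' = (Real.cos (θ - θ') + ε * ε' : ℝ) := by
  simp [isotropicVector, dotProduct, Fin.sum_univ_three, Real.cos_sub]
  linear_combination -(ε : ℂ) * ε' * Complex.I_sq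

/-- The sign of a letter of a word in a free group. -/
def letterSign (b : Bool) : ℝ := if b then 1 else -1

theorem letterSign_sq (b : Bool) : letterSign b ^ 2 = 1 := by cases b <;> simp [letterSign]

theorem cos_add_letterSign_ne_zero {θ θ' : ℝ} (hθ : θ ∈ Set.Ioc (0 : ℝ) 1)
    (hθ' : θ' ∈ Set.Ioc (0 : ℝ) 1) (b b' : Bool) (h : θ = θ' → b = b') :
    Real.cos (θ - θ') + letterSign b * letterSign b' ≠ 0 := by
  by_cases he : θ = θ'
  · obtain rfl := h he
    have := letterSign_sq b
    rw [he, sub_self, Real.cos_zero, ← sq, this]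
    norm_num
  · have hpi := Real.pi_gt_three
    have hpos : 0 < Real.cos (θ - θ') := Real.cos_pos_of_mem_Ioo
      ⟨by linarith [hθ.1, hθ'.2], by linarith [hθ.2, hθ'.1]⟩
    have hne : Real.cos (θ - θ') ≠ 1 := fun h1 => he <| sub_eq_zero.1 <|
      (Real.cos_eq_one_iff_of_lt_of_lt (by linarith [hθ.1, hθ'.2])
        (by linarith [hθ.2, hθ'.1])).1 h1
    cases b <;> cases b' <;> simp only [letterSign] <;> norm_num
    · positivity
    · intro h; apply hne; linarith
    · intro h; apply hne; linarith
    · positivity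

/-- Along a reduced word, consecutive rank-one matrices do not annihilate each other, so their
product maps some vector to a non-zero multiple of the first eigenvector. -/
theorem exists_prod_mulVec {α : Type*} (θ : α → ℝ) (L : List (α × Bool)) (a : α × Bool)
    (hθ : ∀ x ∈ a :: L, θ x.1 ∈ Set.Ioc (0 : ℝ) 1)
    (hinj : ∀ x ∈ a :: L, ∀ y ∈ a :: L, θ x.1 = θ y.1 → x.1 = y.1)
    (hL : FreeGroup.IsReduced (a :: L)) :
    ∃ (v : Fin 3 → ℂ) (k : ℂ), k ≠ 0 ∧
      ((a :: L).map fun x => (2 : ℂ) • Matrix.vecMulVec (isotropicVector (θ x.1) (letterSign x.2))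
        (isotropicVector (θ x.1) (-letterSign x.2))).prod.mulVec v =
      k • isotropicVector (θ a.1) (letterSign a.2) := by
  have step (x y : α × Bool) (hx : θ x.1 ∈ Set.Ioc (0 : ℝ) 1) (hy : θ y.1 ∈ Set.Ioc (0 : ℝ) 1)
      (h : θ x.1 = θ y.1 → x.2 = y.2) (k : ℂ) (hk : k ≠ 0) : ∃ k' : ℂ, k' ≠ 0 ∧
      ((2 : ℂ) • Matrix.vecMulVec (isotropicVector (θ x.1) (letterSign x.2))
        (isotropicVector (θ x.1) (-letterSign x.2))).mulVec
          (k • isotropicVector (θ y.1) (letterSign y.2)) =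
      k' • isotropicVector (θ x.1) (letterSign x.2) := by
    refine ⟨2 * k * (Real.cos (θ x.1 - θ y.1) + letterSign x.2 * letterSign y.2 : ℝ), ?_, ?_⟩
    · have := cos_add_letterSign_ne_zero hx hy x.2 y.2 h
      exact mul_ne_zero (mul_ne_zero two_ne_zero hk) (by exact_mod_cast this)
    · rw [Matrix.smul_mulVec, Matrix.mulVec_smul, Matrix.vecMulVec_mulVec,
        isotropicVector_dotProduct, smul_smul]
      ext i
      simp
      ring
  induction L generalizing a with
  | nil =>
    obtain ⟨k, hk, h⟩ := step a a (hθ a (by simp)) (hθ a (by simp)) (fun _ => rfl) 1 one_ne_zero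
    exact ⟨_, k, hk, by simpa using h⟩
  | cons b L ih =>
    rw [FreeGroup.isReduced_cons_cons] at hL
    obtain ⟨v, k, hk, h⟩ := ih b (fun x hx => hθ x (List.mem_cons_of_mem _ hx))
      (fun x hx y hy => hinj x (List.mem_cons_of_mem _ hx) y (List.mem_cons_of_mem _ hy)) hL.2
    obtain ⟨k', hk', h'⟩ := step a b (hθ a (by simp)) (hθ b (by simp))
      (fun e => hL.1 (hinj a (by simp) b (by simp) e)) k hk
    refine ⟨v, k', hk', ?_⟩
    rw [List.map_cons, List.prod_cons, ← Matrix.mulVec_mulVec, h, h']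

theorem smul_map_rodrigues_letter (t θ : ℝ) (b : Bool) :
    ((1 + t ^ 2 : ℝ) : ℂ) • Complex.ofRealHom.mapMatrix
      (cond b (rodrigues (t * Real.cos θ) (t * Real.sin θ) 0)
        (rodrigues (t * Real.cos θ) (t * Real.sin θ) 0)⁻¹).1 =
    rodriguesMatrix (letterSign b * t * (Real.cos θ : ℂ)) (letterSign b * t * (Real.sin θ : ℂ))
      0 := by
  have hb : cond b (rodrigues (t * Real.cos θ) (t * Real.sin θ) 0)
        (rodrigues (t * Real.cos θ) (t * Real.sin θ) 0)⁻¹ =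
      rodrigues (letterSign b * t * Real.cos θ) (letterSign b * t * Real.sin θ) 0 := by
    cases b <;> simp [letterSign, rodrigues_inv]
  have hN : 1 + (letterSign b * t * Real.cos θ) ^ 2 + (letterSign b * t * Real.sin θ) ^ 2 + 0 ^ 2 =
      1 + t ^ 2 := by
    linear_combination t ^ 2 * letterSign b ^ 2 * Real.cos_sq_add_sin_sq θ +
      t ^ 2 * letterSign_sq b
  have hmap := rodriguesMatrix_map Complex.ofRealHom (letterSign b * t * Real.cos θ)
    (letterSign b * t * Real.sin θ) 0
  simp only [_root_.map_mul, _root_.map_zero, Complex.ofRealHom_eq_coe] at hmap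
  rw [← hmap, hb]
  ext i j
  simp only [Matrix.smul_apply, RingHom.mapMatrix_apply, Matrix.map_apply, rodrigues_apply, hN,
    Complex.ofRealHom_eq_coe, smul_eq_mul]
  rw [← Complex.ofReal_mul, mul_inv_cancel_left₀ (by positivity)]

open Polynomial in
/-- Every non-trivial word takes a value different from `1` at some tuple of rotations. -/
theorem exists_lift_SO3_ne_one {α : Type*} (w : FreeGroup α) (hw : w ≠ 1) :
    ∃ r : α → SO3, FreeGroup.lift r w ≠ 1 := by
  classical
  by_contra! hr
  obtain ⟨a, L, haL⟩ := List.exists_cons_of_ne_nil (mt FreeGroup.toWord_eq_nil_iff.1 hw)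
  obtain ⟨m, hm⟩ := Set.countable_iff_exists_injOn.1
    (w.toWord.map Prod.fst).toFinset.countable_toSet
  -- The axes of the rotations are horizontal, at the distinct angles `1 / (m x + 1)`.
  let θ : α → ℝ := fun x => 1 / ((m x : ℝ) + 1)
  have hθ (x : α) : θ x ∈ Set.Ioc (0 : ℝ) 1 :=
    ⟨by positivity, by
      rw [div_le_one (by positivity)]
      linarith [(m x).cast_nonneg (α := ℝ)]⟩
  have hinj : ∀ x ∈ a :: L, ∀ y ∈ a :: L, θ x.1 = θ y.1 → x.1 = y.1 := by
    intro x hx y hy h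
    rw [← haL] at hx hy
    refine hm (by simpa using List.mem_map_of_mem (f := Prod.fst) hx)
      (by simpa using List.mem_map_of_mem (f := Prod.fst) hy) ?_
    have : (m x.1 : ℝ) + 1 = m y.1 + 1 := by
      simpa [θ] using h
    exact_mod_cast add_right_cancel this
  -- The numerators as matrices of polynomials in the tangent of the half-angle.
  let P : α × Bool → Matrix (Fin 3) (Fin 3) ℂ[X] := fun x =>
    rodriguesMatrix (C (letterSign x.2 : ℂ) * X * C (Real.cos (θ x.1) : ℂ))
      (C (letterSign x.2 : ℂ) * X * C (Real.sin (θ x.1) : ℂ)) 0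
  have hPeval (z : ℂ) (x : α × Bool) : (evalRingHom z).mapMatrix (P x) =
      rodriguesMatrix (letterSign x.2 * z * (Real.cos (θ x.1) : ℂ))
        (letterSign x.2 * z * (Real.sin (θ x.1) : ℂ)) 0 := by
    rw [RingHom.mapMatrix_apply, rodriguesMatrix_map]
    simp
  let N : ℂ[X] := (1 + X ^ 2) ^ w.toWord.length
  have hreal (t : ℝ) : (evalRingHom (t : ℂ)).mapMatrix (w.toWord.map P).prod =
      (evalRingHom (t : ℂ)).mapMatrix (N • 1) := by
    have h := hr fun x => rodrigues (t * Real.cos (θ x)) (t * Real.sin (θ x)) 0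
    rw [← FreeGroup.mk_toWord (x := w), FreeGroup.lift_mk] at h
    -- Clearing denominators letter by letter turns the value of a word into the product of the
    -- numerators.
    have h' (l : List (α × Bool)) : ((1 + t ^ 2 : ℝ) : ℂ) ^ l.length • Complex.ofRealHom.mapMatrix
        (l.map fun x => cond x.2 (rodrigues (t * Real.cos (θ x.1)) (t * Real.sin (θ x.1)) 0)
          (rodrigues (t * Real.cos (θ x.1)) (t * Real.sin (θ x.1)) 0)⁻¹).prod.1 =
        (evalRingHom (t : ℂ)).mapMatrix (l.map P).prod := by
      induction l with
      | nil => simp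
      | cons x l ih =>
        rw [List.map_cons, List.prod_cons, List.map_cons, List.prod_cons, _root_.map_mul, ← ih,
          hPeval, Submonoid.coe_mul, _root_.map_mul, List.length_cons, pow_succ', ← smul_smul,
          ← Matrix.mul_smul, ← Matrix.smul_mul]
        congr 1
        exact smul_map_rodrigues_letter t (θ x.1) x.2
    rw [← h' w.toWord, h]
    ext i j
    by_cases hij : i = j <;> simp [N, hij]
  have hpoly : (w.toWord.map P).prod = N • 1 := by
    ext i j : 1
    refine Polynomial.eq_of_infinite_eval_eq _ _ (Set.infinite_of_injective_forall_mem
      (f := fun t : ℝ => (t : ℂ)) Complex.ofReal_injective fun t => ?_)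
    exact congrFun (congrFun (hreal t) i) j
  have hzero : (evalRingHom Complex.I).mapMatrix (w.toWord.map P).prod = 0 := by
    have hN : N.eval Complex.I = 0 := by simp [N, haL]
    ext i j
    rw [hpoly]
    simp [hN]
  rw [map_list_prod, List.map_map, haL] at hzero
  obtain ⟨v, k, hk, hv⟩ := exists_prod_mulVec θ L a (fun x _ => hθ x.1) hinj
    (haL ▸ FreeGroup.isReduced_toWord)
  have hfun : (fun x : α × Bool => (2 : ℂ) • Matrix.vecMulVec
      (isotropicVector (θ x.1) (letterSign x.2)) (isotropicVector (θ x.1) (-letterSign x.2))) =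
      (evalRingHom Complex.I).mapMatrix ∘ P := by
    funext x
    rw [Function.comp_apply, hPeval, rodriguesMatrix_at_I _ _ (letterSign_sq _)]
  rw [hfun, hzero, Matrix.zero_mulVec] at hv
  have h2 := congrFun hv 2
  cases hb : a.2 <;> simp [isotropicVector, letterSign, hk, hb] at h2

/-! ### Open sets in powers of a compact group -/

/-- A compact group has the countable chain condition, because its Haar measure is finite and
positive on non-empty open sets. -/
theorem countable_of_pairwise_disjoint_isOpen {K ι : Type*} [Group K] [TopologicalSpace K]
    [IsTopologicalGroup K] [CompactSpace K] {U : ι → Set K} (ho : ∀ i, IsOpen (U i))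
    (hne : ∀ i, (U i).Nonempty) (hd : Pairwise (Function.onFun Disjoint U)) : Countable ι := by
  let _ : MeasurableSpace K := borel K
  have : BorelSpace K := ⟨rfl⟩
  have h := MeasureTheory.Measure.countable_meas_pos_of_disjoint_iUnion
    (μ := MeasureTheory.Measure.haar) (fun i => (ho i).measurableSet) hd
  rw [← Set.countable_univ_iff]
  convert h
  ext i
  simp [(ho i).measure_pos _ (hne i)]

/-- Every neighbourhood in a power contains an open cylinder over finitely many coordinates. -/
theorem exists_finset_cylinder_subset {ι G : Type*} [TopologicalSpace G] {U : Set (ι → G)}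
    (hU : IsOpen U) {x : ι → G} (hx : x ∈ U) :
    ∃ (F : Finset ι) (B : Set (ι → G)), IsOpen B ∧ x ∈ B ∧ B ⊆ U ∧
      DependsOn (fun y => y ∈ B) (F : Set ι) := by
  obtain ⟨F, u, hu, hF⟩ := isOpen_pi_iff.1 hU x hx
  refine ⟨F, (F : Set ι).pi u, isOpen_set_pi F.finite_toSet fun i hi => (hu i hi).1,
    fun i hi => (hu i hi).2, hF, fun y z h => ?_⟩
  refine propext (forall₂_congr fun i hi => ?_)
  rw [h i hi]

/-- In a power of a compact group the closure of an open set `U` depends on countably many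
coordinates: it is the closure of the union of a maximal disjoint family of open cylinders
contained in `U`, and such a family is countable. -/
theorem exists_countable_dependsOn_closure {ι G : Type*} [Group G] [TopologicalSpace G]
    [IsTopologicalGroup G] [CompactSpace G] {U : Set (ι → G)} (hU : IsOpen U) :
    ∃ A : Set ι, A.Countable ∧ DependsOn (fun x => x ∈ closure U) A := by
  let 𝒞 : Set (Set (ι → G)) := {B | IsOpen B ∧ B.Nonempty ∧ B ⊆ U ∧
    ∃ F : Finset ι, DependsOn (fun y => y ∈ B) (F : Set ι)}
  obtain ⟨c, hc⟩ := zorn_subset {c : Set (Set (ι → G)) | c ⊆ 𝒞 ∧ c.PairwiseDisjoint id} (by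
    intro s hs hchain
    refine ⟨⋃₀ s, ⟨Set.sUnion_subset fun c hc => (hs hc).1, ?_⟩, fun c => Set.subset_sUnion_of_mem⟩
    exact (Set.pairwiseDisjoint_sUnion hchain.directedOn).2 fun c hc => (hs hc).2)
  have hcP : c ⊆ 𝒞 := hc.prop.1
  have hcount : Countable c := countable_of_pairwise_disjoint_isOpen (U := fun B : c => (B : Set (ι → G)))
    (fun B => (hcP B.2).1) (fun B => (hcP B.2).2.1)
    fun B B' h => hc.prop.2 B.2 B'.2 (Subtype.coe_injective.ne h : (B : Set (ι → G)) ≠ B')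
  choose F hF using fun B : c => (hcP B.2).2.2.2
  let A : Set ι := ⋃ B, (F B : Set ι)
  have hVA : ∀ x y, (∀ i ∈ A, x i = y i) → x ∈ ⋃₀ c → y ∈ ⋃₀ c := by
    rintro x y hxy ⟨B, hB, hxB⟩
    refine ⟨B, hB, ?_⟩
    exact (hF ⟨B, hB⟩ fun i hi => hxy i (Set.mem_iUnion.2 ⟨_, hi⟩)).mp hxB
  have hcl : closure (⋃₀ c) = closure U := by
    refine (closure_mono (Set.sUnion_subset fun B hB => (hcP hB).2.2.1)).antisymm
      (closure_minimal (fun x hx => ?_) isClosed_closure)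
    by_contra hxc
    obtain ⟨E, B, hBo, hxB, hBU, hBE⟩ := exists_finset_cylinder_subset
      (hU.inter isClosed_closure.isOpen_compl) ⟨hx, hxc⟩
    have hdisj : ∀ B' ∈ c, Disjoint B B' := fun B' hB' => Set.disjoint_left.2 fun y hy hy' =>
      (hBU hy).2 (subset_closure ⟨B', hB', hy'⟩)
    have hmem : B ∈ c := hc.mem_of_prop_insert ⟨Set.insert_subset
      ⟨hBo, ⟨x, hxB⟩, fun y hy => (hBU hy).1, E, hBE⟩ hcP,
      hc.prop.2.insert fun B' hB' _ => hdisj B' hB'⟩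
    exact (hBU hxB).2 (subset_closure ⟨B, hmem, hxB⟩)
  have key : ∀ x y, (∀ i ∈ A, x i = y i) → x ∈ closure (⋃₀ c) → y ∈ closure (⋃₀ c) := by
    classical
    intro x y hxy hx
    -- Replacing all coordinates outside `A` by those of `y` preserves the union of the family.
    have hT : Continuous fun z : ι → G => A.piecewise z y := by
      refine continuous_pi fun i => ?_
      by_cases hi : i ∈ A
      · simpa [hi] using continuous_apply i
      · simpa [hi] using continuous_const
    have hxT : A.piecewise x y = y := by
      funext i
      by_cases hi : i ∈ A
      · simp [hi, hxy i hi]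
      · simp [hi]
    rw [← hxT]
    refine map_mem_closure (f := fun z : ι → G => A.piecewise z y) hT hx fun z hz => hVA z _ (fun i hi => ?_) hz
    simp [hi]
  refine ⟨A, Set.countable_iUnion fun B => (F B).countable_toSet, fun x y hxy => ?_⟩
  rw [← hcl]
  exact propext ⟨key x y hxy, key y x fun i hi => (hxy i hi).symm⟩

theorem dense_of_forall_countable {ι G : Type*} [TopologicalSpace G] {D : Set (ι → G)}
    (hD : ∀ A : Set ι, A.Countable → ∀ z : ι → G, ∃ d ∈ D, ∀ i ∈ A, d i = z i) : Dense D := by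
  rw [dense_iff_inter_open]
  rintro O hO ⟨x, hx⟩
  obtain ⟨F, B, -, hxB, hBO, hBF⟩ := exists_finset_cylinder_subset hO hx
  obtain ⟨d, hd, hdx⟩ := hD F F.countable_toSet x
  exact ⟨d, hBO ((hBF hdx).mpr hxB), hd⟩

theorem hasBasis_nhds_pi_isPreconnected {ι G : Type*} [TopologicalSpace G] [ConnectedSpace G]
    [LocallyConnectedSpace G] (x : ι → G) :
    (𝓝 x).HasBasis (fun W => x ∈ W ∧ IsOpen W ∧ IsPreconnected W ∧
      ∃ F : Finset ι, DependsOn (fun y => y ∈ W) (F : Set ι)) id := by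
  classical
  refine ⟨fun t => ⟨fun ht => ?_, fun ⟨W, hW, hWt⟩ => mem_of_superset (hW.2.1.mem_nhds hW.1) hWt⟩⟩
  obtain ⟨U, hUt, hU, hxU⟩ := mem_nhds_iff.1 ht
  obtain ⟨F, u, hu, hF⟩ := isOpen_pi_iff.1 hU x hxU
  have hV (i : ι) : ∃ V : Set G, (i ∈ F → V ⊆ u i) ∧ IsOpen V ∧ x i ∈ V ∧ IsConnected V := by
    by_cases hi : i ∈ F
    · obtain ⟨V, h, hV⟩ := locallyConnectedSpace_iff_subsets_isOpen_isConnected.1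
        (inferInstanceAs (LocallyConnectedSpace G)) (x i) (u i) ((hu i hi).1.mem_nhds (hu i hi).2)
      exact ⟨V, fun _ => h, hV⟩
    · exact ⟨Set.univ, fun h => absurd h hi, isOpen_univ, Set.mem_univ _, isConnected_univ⟩
  choose V hVu hVo hxV hVc using hV
  refine ⟨(F : Set ι).pi V, ⟨fun i _ => hxV i, isOpen_set_pi F.finite_toSet fun i _ => hVo i, ?_,
    F, fun y z h => propext (forall₂_congr fun i hi => by rw [h i hi])⟩,
    fun y hy => hUt (hF fun i hi => hVu i hi (hy i hi))⟩
  have : (F : Set ι).pi V = Set.univ.pi fun i => if i ∈ F then V i else Set.univ := by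
    ext y
    refine forall_congr' fun i => ?_
    by_cases hi : i ∈ F <;> simp [hi]
  rw [this]
  refine isPreconnected_univ_pi fun i => ?_
  split_ifs
  · exact (hVc i).isPreconnected
  · exact isPreconnected_univ

/-- A subset of a power of a compact group that takes all prescribed values on countably many
coordinates meets an open connected set depending on countably many coordinates in a connected
set. A separation by open sets `U` and `V` would be refuted at a point of the subset in the
intersection of the closures of `U` and `V`. -/
theorem IsPreconnected.inter_of_forall_countable {ι G : Type*} [Group G] [TopologicalSpace G]
    [IsTopologicalGroup G] [CompactSpace G] {D W : Set (ι → G)}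
    (hD : ∀ A : Set ι, A.Countable → ∀ z : ι → G, ∃ d ∈ D, ∀ i ∈ A, d i = z i)
    (hW : IsPreconnected W) (hWo : IsOpen W) {A : Set ι} (hA : A.Countable)
    (hWA : DependsOn (fun x => x ∈ W) A) : IsPreconnected (W ∩ D) := by
  have hdense : Dense D := dense_of_forall_countable hD
  intro U V hU hV hUV hDU hDV
  by_contra hempty
  have hdisj : ∀ x ∈ W, x ∈ U → x ∉ V := by
    intro x hxW hxU hxV
    obtain ⟨d, hd, hdD⟩ := dense_iff_inter_open.1 hdense _ (hWo.inter (hU.inter hV))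
      ⟨x, hxW, hxU, hxV⟩
    exact hempty ⟨d, ⟨hd.1, hdD⟩, hd.2⟩
  have hcover : W ⊆ closure (U ∩ W) ∪ closure (V ∩ W) := by
    rw [← closure_union, ← Set.union_inter_distrib_right]
    refine (hdense.open_subset_closure_inter hWo).trans (closure_mono fun x hx => ?_)
    exact ⟨hUV hx, hx.1⟩
  obtain ⟨z, hzW, hzU, hzV⟩ := isPreconnected_closed_iff.1 hW _ _ isClosed_closure isClosed_closure
    hcover (hDU.mono fun x hx => ⟨hx.1.1, subset_closure ⟨hx.2, hx.1.1⟩⟩)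
    (hDV.mono fun x hx => ⟨hx.1.1, subset_closure ⟨hx.2, hx.1.1⟩⟩)
  obtain ⟨A₁, hA₁, hUA⟩ := exists_countable_dependsOn_closure (hU.inter hWo)
  obtain ⟨A₂, hA₂, hVA⟩ := exists_countable_dependsOn_closure (hV.inter hWo)
  obtain ⟨d, hdD, hdz⟩ := hD (A ∪ (A₁ ∪ A₂)) (hA.union (hA₁.union hA₂)) z
  have hdW : d ∈ W := (hWA fun i hi => hdz i (by simp [hi])).mpr hzW
  have hdU : d ∈ closure (U ∩ W) := (hUA fun i hi => hdz i (by simp [hi])).mpr hzU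
  have hdV : d ∈ closure (V ∩ W) := (hVA fun i hi => hdz i (by simp [hi])).mpr hzV
  rcases hUV ⟨hdW, hdD⟩ with h | h
  · obtain ⟨y, hyU, hyV⟩ := mem_closure_iff.1 hdV U hU h
    exact hdisj y hyV.2 hyU hyV.1
  · obtain ⟨y, hyV, hyU⟩ := mem_closure_iff.1 hdU V hV h
    exact hdisj y hyU.2 hyU.1 hyV

/-! ### The free generators -/

/-- Convergent sequences in `ℕ → SO3` together with their limits, the latter indexed by `none`. -/
abbrev ConvergentFamily : Type :=
  {f : Option ℕ → ℕ → SO3 // Tendsto (fun n => f (some n)) atTop (𝓝 (f none))}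

/-- Prescriptions of a convergent sequence on the countably many coordinates `a 0, a 1, …` of
`S → SO3`. The sequence `a` may have repetitions; a coordinate is then assigned one of its
indices. -/
abbrev Prescription (S : Type*) : Type _ := (ℕ → S) × ConvergentFamily

/-- One generator for each term, and one for the limit, of each prescribed sequence. -/
abbrev Generator (S : Type*) : Type _ := Prescription S × Option ℕ

theorem mk_generator {S : Type u} (hS : Cardinal.aleph0 ≤ Cardinal.mk S)
    (hpow : Cardinal.mk S ^ Cardinal.aleph0 = Cardinal.mk S) :
    Cardinal.mk (Generator S) = Cardinal.mk S := by
  have hcont : Cardinal.continuum ≤ Cardinal.mk S := by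
    rw [← hpow, ← Cardinal.two_power_aleph0]
    exact Cardinal.power_le_power_right ((Cardinal.natCast_le_aleph0 (n := 2)).trans hS)
  have hSO3 : Cardinal.mk SO3 ≤ Cardinal.continuum := by
    refine (Cardinal.mk_subtype_le _).trans ?_
    change Cardinal.mk (Fin 3 → Fin 3 → ℝ) ≤ _
    have h (n : ℕ) : Cardinal.continuum ^ (n : Cardinal) ≤ Cardinal.continuum :=
      Cardinal.power_nat_le Cardinal.aleph0_le_continuum
    have h3 : Cardinal.mk (Fin 3 → Fin 3 → ℝ) =
        (Cardinal.continuum ^ ((3 : ℕ) : Cardinal)) ^ ((3 : ℕ) : Cardinal) := by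
      simp [Cardinal.mk_real]
    rw [h3]
    exact (Cardinal.power_le_power_right (h 3)).trans (h 3)
  have hC : Cardinal.mk ConvergentFamily ≤ Cardinal.continuum := by
    refine (Cardinal.mk_subtype_le _).trans ?_
    have : Cardinal.mk (Option ℕ → ℕ → SO3) =
        (Cardinal.mk SO3 ^ Cardinal.aleph0) ^ Cardinal.aleph0 := by simp
    rw [this, ← Cardinal.power_mul, Cardinal.aleph0_mul_aleph0]
    exact (Cardinal.power_le_power_right hSO3).trans (by simp)
  have hC' : Cardinal.lift.{u} (Cardinal.mk ConvergentFamily) ≤ Cardinal.mk S :=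
    (Cardinal.lift_le.2 hC).trans (by simpa using hcont)
  have hC0 : Cardinal.mk ConvergentFamily ≠ 0 :=
    Cardinal.mk_ne_zero_iff.2 ⟨⟨fun _ _ => 1, tendsto_const_nhds⟩⟩
  have hfun : Cardinal.mk (ℕ → S) = Cardinal.mk S := by simpa using hpow
  have hpre : Cardinal.mk (Prescription S) = Cardinal.mk S := by
    rw [Cardinal.mk_prod, hfun, Cardinal.lift_id']
    exact Cardinal.mul_eq_left hS (by simpa using hC') (by simpa using hC0)
  rw [Cardinal.mk_prod, hpre, Cardinal.lift_id']
  exact Cardinal.mul_eq_left hS (by simpa using hS) (by simp [Cardinal.aleph0_ne_zero])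

open Classical in
/-- The coordinates of the generators. On the countably many coordinates of its prescription a
generator takes the prescribed values; the other coordinates are labelled by words and follow
`r (label s)`. -/
noncomputable def generatorValue {S W : Type*} (label : S → W) (r : W → Generator S → SO3)
    (x : Generator S) (s : S) : SO3 :=
  if h : ∃ k, x.1.1 k = s then x.1.2.1 x.2 h.choose else r (label s) x

theorem generatorValue_apply {S W : Type*} (label : S → W) (r : W → Generator S → SO3)
    {a : ℕ → S} (f : ConvergentFamily) {n : Option ℕ} {z : S → SO3}
    (hz : ∀ k, f.1 n k = z (a k)) (k : ℕ) :
    generatorValue label r ((a, f), n) (a k) = z (a k) := by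
  have h : ∃ k', a k' = a k := ⟨k, rfl⟩
  rw [generatorValue, dif_pos h]
  exact (hz _).trans (congrArg z h.choose_spec)

theorem tendsto_generatorValue {S W : Type*} (label : S → W) {r : W → Generator S → SO3}
    (hr : ∀ w j, ∀ᶠ n in atTop, r w (j, some n) = r w (j, none)) (j : Prescription S) :
    Tendsto (fun n => generatorValue label r (j, some n)) atTop
      (𝓝 (generatorValue label r (j, none))) := by
  refine tendsto_pi_nhds.2 fun s => ?_
  by_cases h : ∃ k, j.1 k = s
  · simp only [generatorValue, dif_pos h]
    exact tendsto_pi_nhds.1 j.2.2 _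
  · simp only [generatorValue, dif_neg h]
    exact tendsto_const_nhds.congr' ((hr _ j).mono fun n hn => hn.symm)

/-- A non-trivial word in the generators survives under an assignment of rotations that is
eventually constant along each prescribed sequence, because it involves finitely many letters. -/
theorem exists_lift_ne_one_eventually_const {J : Type*} (w : FreeGroup (J × Option ℕ)) :
    ∃ r : J × Option ℕ → SO3, (w ≠ 1 → FreeGroup.lift r w ≠ 1) ∧
      ∀ j, ∀ᶠ n in atTop, r (j, some n) = r (j, none) := by
  classical
  by_cases hw : w = 1
  · exact ⟨fun _ => 1, fun h => absurd hw h, fun j => by simp⟩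
  obtain ⟨r, hr⟩ := exists_lift_SO3_ne_one w hw
  obtain ⟨F, hF⟩ := FreeGroup.exists_finset_lift_eq (G := SO3) w
  refine ⟨fun x => if x ∈ F then r x else r (x.1, none), fun _ => ?_, fun j => ?_⟩
  · rwa [← hF r _ fun x hx => by simp [Finset.mem_coe.1 hx]]
  · have hfin : {n | (j, some n) ∈ F}.Finite :=
      F.finite_toSet.preimage (f := fun n : ℕ => (j, some n)) fun n _ m _ h => by simpa using h
    have := hfin.eventually_cofinite_notMem
    rw [Nat.cofinite_eq_atTop] at this
    filter_upwards [this] with n hn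
    have hn' : (j, some n) ∉ F := hn
    simp [hn']

theorem injective_lift_generatorValue {S : Type*} {label : S → FreeGroup (Generator S)}
    (hlabel : ∀ w, ¬ (label ⁻¹' {w}).Countable)
    {r : FreeGroup (Generator S) → Generator S → SO3}
    (hr : ∀ w, w ≠ 1 → FreeGroup.lift (r w) w ≠ 1) :
    Function.Injective (FreeGroup.lift (generatorValue label r)) := by
  rw [injective_iff_map_eq_one]
  intro w hw
  by_contra hw1
  obtain ⟨F, hF⟩ := FreeGroup.exists_finset_lift_eq (G := SO3) w
  -- Among the uncountably many coordinates labelled by `w` there is one at which no letter of `w`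
  -- has a prescribed value.
  have hA : (⋃ x ∈ F, Set.range x.1.1).Countable :=
    F.countable_toSet.biUnion fun x _ => Set.countable_range _
  obtain ⟨s, hs, hsA⟩ := Set.not_subset.1 fun h => hlabel w (hA.mono h)
  refine hr w hw1 ?_
  have h1 : (Pi.evalMonoidHom (fun _ : S => SO3) s).comp
      (FreeGroup.lift (generatorValue label r)) =
      FreeGroup.lift fun x => generatorValue label r x s := by
    ext x : 1
    simp
  have h2 : FreeGroup.lift (fun x => generatorValue label r x s) w = 1 := by
    rw [← h1, MonoidHom.comp_apply, hw, _root_.map_one]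
  rw [← h2]
  refine hF _ _ fun x hx => ?_
  have hx' : ¬ ∃ k, x.1.1 k = s := fun h => hsA (Set.mem_biUnion hx h)
  have hs' : label s = w := hs
  rw [generatorValue, dif_neg hx', hs']

theorem exists_generatorValue_eq {S W : Type*} [Nonempty S] (label : S → W)
    (r : W → Generator S → SO3) {A : Set S} (hA : A.Countable) (z : S → SO3) :
    ∃ x, ∀ s ∈ A, generatorValue label r x s = z s := by
  obtain ⟨a, ha⟩ := Set.countable_iff_exists_subset_range.1 hA
  let f : ConvergentFamily := ⟨fun _ k => z (a k), tendsto_const_nhds⟩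
  refine ⟨((a, f), none), fun s hs => ?_⟩
  obtain ⟨k, rfl⟩ := ha hs
  exact generatorValue_apply label r f (fun _ => rfl) k

/-- Given points `p n ∈ U n`, restrict them to countably many coordinates on which membership in
the sets `U n` is decided, pass to a subsequence converging on these coordinates, and replace it by
the generators for which it is prescribed. -/
theorem exists_generatorValue_mem {S W : Type*} [Nonempty S] (label : S → W)
    (r : W → Generator S → SO3)
    {V : ℕ → Set (S → SO3)} (hV : ∀ n, IsOpen (V n)) {p : ℕ → S → SO3} (hp : ∀ n, p n ∈ V n) :
    ∃ (j : Prescription S) (φ : ℕ → ℕ), StrictMono φ ∧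
      ∀ n, generatorValue label r (j, some n) ∈ V (φ n) := by
  choose F B hBo hpB hBV hBF using fun n => exists_finset_cylinder_subset (hV n) (hp n)
  have hA : (⋃ n, (F n : Set S)).Countable :=
    Set.countable_iUnion fun n => (F n).countable_toSet
  obtain ⟨a, ha⟩ : ∃ a : ℕ → S, (⋃ n, (F n : Set S)) ⊆ Set.range a := Set.countable_iff_exists_subset_range.1 hA
  obtain ⟨q, φ, hφ, hq⟩ := CompactSpace.tendsto_subseq fun n k => p n (a k)
  let f : ConvergentFamily := ⟨fun o => o.elim q fun n k => p (φ n) (a k), hq⟩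
  refine ⟨(a, f), φ, hφ, fun n => hBV _ ((hBF _ fun s hs => ?_).mp (hpB (φ n)))⟩
  obtain ⟨k, rfl⟩ := ha (Set.mem_iUnion.2 ⟨φ n, hs⟩)
  exact (generatorValue_apply label r f (fun k => rfl) k).symm

theorem exists_label {S W : Type u} (hunc : Cardinal.aleph0 < Cardinal.mk S)
    (hW : Cardinal.mk W ≤ Cardinal.mk S) [Nonempty W] :
    ∃ label : S → W, ∀ w, ¬ (label ⁻¹' {w}).Countable := by
  have hc : Cardinal.mk (W × S) = Cardinal.mk S := by
    rw [Cardinal.mk_prod, Cardinal.lift_id, Cardinal.lift_id]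
    exact Cardinal.mul_eq_right hunc.le hW (Cardinal.mk_ne_zero W)
  obtain ⟨e⟩ := Cardinal.eq.1 hc
  refine ⟨fun s => (e.symm s).1, fun w h => ?_⟩
  have h2 : (Set.univ : Set S).Countable := by
    refine (h.preimage_of_injOn (f := fun s => e (w, s)) ?_).mono fun s _ => by simp
    intro s _ t _ hst
    simpa using hst
  rw [Set.countable_univ_iff, ← Cardinal.mk_le_aleph0_iff] at h2
  exact hunc.not_ge h2

/-! ### The induced topology -/

theorem theorem3p7 (σ : Cardinal.{u}) (hσ : Cardinal.aleph0 ≤ σ) (hpow : σ ^ Cardinal.aleph0 = σ)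
    (S : Type u) (hS : Cardinal.mk S = σ) :
    ∃ _ : TopologicalSpace (FreeGroup S),
      IsTopologicalGroup (FreeGroup S) ∧
      T2Space (FreeGroup S) ∧
      ConnectedSpace (FreeGroup S) ∧
      LocallyConnectedSpace (FreeGroup S) ∧
      SelectivelySequentiallyPseudocompact (FreeGroup S) ∧
      ∃ ι : FreeGroup S →* (S → SO3), IsEmbedding ι ∧ DenseRange ι := by
  subst hS
  have : Infinite S := Cardinal.infinite_iff.2 hσ
  have hunc : Cardinal.aleph0 < Cardinal.mk S := by
    rw [← hpow]
    exact (Cardinal.cantor _).trans_le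
      (Cardinal.power_le_power_right ((Cardinal.natCast_le_aleph0 (n := 2)).trans hσ))
  have hgen := mk_generator hσ hpow
  obtain ⟨e⟩ := Cardinal.eq.1 hgen
  have : Nonempty (Generator S) := ⟨e.symm (Classical.arbitrary S)⟩
  obtain ⟨label, hlabel⟩ := exists_label (W := FreeGroup (Generator S)) hunc
    (by rw [Cardinal.mk_freeGroup, hgen, max_eq_left hσ])
  choose r hr1 hr using fun w : FreeGroup (Generator S) => exists_lift_ne_one_eventually_const w
  let g : Generator S → S → SO3 := generatorValue label r
  let ι : FreeGroup S →* (S → SO3) :=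
    (FreeGroup.lift g).comp (FreeGroup.freeGroupCongr e).symm.toMonoidHom
  have hinj : Function.Injective ι :=
    (injective_lift_generatorValue hlabel hr1).comp (FreeGroup.freeGroupCongr e).symm.injective
  have hιg (x : Generator S) : ι (FreeGroup.of (e x)) = g x := by
    simp [ι]
  have hD : ∀ A : Set S, A.Countable → ∀ z : S → SO3, ∃ d ∈ Set.range ι, ∀ i ∈ A, d i = z i := by
    intro A hA z
    obtain ⟨x, hx⟩ := exists_generatorValue_eq label r hA z
    exact ⟨g x, ⟨_, hιg x⟩, hx⟩
  let _ : TopologicalSpace (FreeGroup S) := TopologicalSpace.induced ι inferInstance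
  have hind : IsInducing ι := ⟨rfl⟩
  have hemb : IsEmbedding ι := ⟨hind, hinj⟩
  have hpre {W : Set (S → SO3)} (hWo : IsOpen W) (hW : IsPreconnected W) {F : Set S}
      (hF : F.Countable) (hWF : DependsOn (fun x => x ∈ W) F) : IsPreconnected (ι ⁻¹' W) := by
    rw [← hind.isPreconnected_image, Set.image_preimage_eq_inter_range]
    exact hW.inter_of_forall_countable hD hWo hF hWF
  refine ⟨inferInstance, topologicalGroup_induced ι, hemb.t2Space, ?_, ?_, ?_, ι, hemb, ?_⟩
  · have : PreconnectedSpace (FreeGroup S) := ⟨hpre isOpen_univ isPreconnected_univ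
      Set.countable_empty fun _ _ _ => rfl⟩
    exact { toNonempty := ⟨1⟩ }
  · refine locallyConnectedSpace_of_connected_bases
      (fun x (W : Set (S → SO3)) => ι ⁻¹' W)
      (fun x W => ι x ∈ W ∧ IsOpen W ∧ IsPreconnected W ∧
        ∃ F : Finset S, DependsOn (fun y => y ∈ W) (F : Set S)) (fun x => ?_) ?_
    · rw [hind.nhds_eq_comap]
      exact (hasBasis_nhds_pi_isPreconnected (ι x)).comap ι
    · rintro x W ⟨-, hWo, hWc, F, hF⟩
      exact hpre hWo hWc F.countable_toSet hF
  · intro U hU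
    choose V hV hUV using fun n => isOpen_induced_iff.1 (hU n).1
    choose p hp using fun n => (hU n).2
    obtain ⟨j, φ, hφ, hj⟩ := exists_generatorValue_mem label r hV
      (p := fun n => ι (p n)) (fun n => by rw [← Set.mem_preimage, hUV]; exact hp n)
    refine ⟨Function.extend φ (fun n => FreeGroup.of (e (j, some n))) p, fun n => ?_,
      FreeGroup.of (e (j, none)), φ, hφ, ?_⟩
    · by_cases h : ∃ k, φ k = n
      · obtain ⟨k, rfl⟩ := h
        rw [hφ.injective.extend_apply, ← hUV, Set.mem_preimage, hιg]
        exact hj k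
      · rw [Function.extend_apply' _ _ _ h]
        exact hp n
    · rw [Function.extend_comp hφ.injective, hind.tendsto_nhds_iff, hιg]
      simpa only [Function.comp_def, hιg] using tendsto_generatorValue label hr j
  · exact dense_of_forall_countable hD
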